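/- Let $P$ be a submonoid of a group $G$. A word is a finite sequence $\alpha=(p_1,p_2,\dots,p_{2k})$ of even length in $P$; put $\dot\alpha=p_1^{-1}p_2\cdots p_{2k-1}^{-1}p_{2k}\in G$, call $\alpha$ neutral if $\dot\alpha=e$, and let $$K(\alpha)=P\cap p_{2k}^{-1}p_{2k-1}P\cap p_{2k}^{-1}p_{2k-1}p_{2k-2}^{-1}p_{2k-3}P\cap\dots\cap \dot\alpha^{-1}P .$$ The sets $K(\alpha)$ are the constructible right ideals of $P$; such an ideal is proper if it is not equal to $P$. For a map $w$ from $P$ to a unital $\mathrm C^*$-algebra put $\dot w_\alpha=w_{p_1}^*w_{p_2}\cdots w_{p_{2k-1}}^*w_{p_{2k}}$. The universal Toeplitz algebra $\mathcal T_u(P)$ is the universal unital $\mathrm C^*$-algebra generated by elements $t_p$ ($p\in P$) subject to: (T1) $t_e=1$; (T2) $\dot t_\alpha=0$ for every neutral $\alpha$ with $K(\alpha)=\emptyset$; (T3) $\dot t_\alpha=\dot t_\beta$ for all neutral $\alpha,\beta$ with $K(\alpha)=K(\beta)$; (T4) $\prod_{\beta\in F}(\dot t_\alpha-\dot t_\beta)=0$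 for every neutral $\alpha$ and every nonempty finite set $F$ of neutral words with $K(\alpha)=\bigcup_{\beta\in F}K(\beta)$. The reduced Toeplitz algebra $\mathcal T_\lambda(P)\subseteq\mathcal B(\ell^2(P))$ is the $\mathrm C^*$-algebra generated by the isometries $L_p$, $L_p\delta_q=\delta_{pq}$, and $\lambda^+\colon\mathcal T_u(P)\to\mathcal T_\lambda(P)$ is the $*$-homomorphism with $\lambda^+(t_p)=L_p$. The full diagonal is $D_u=\overline{\operatorname{span}}\{\dot t_\alpha:\dot\alpha=e\}\subseteq\mathcal T_u(P)$ and the reduced diagonal is $D_r=\overline{\operatorname{span}}\{\dot L_\alpha:\dot\alpha=e\}\subseteq\mathcal T_\lambda(P)$, where for neutral $\alpha$ the operator $\dot L_\alpha$ is multiplication by the characteristic function of $K(\alpha)$. A unital $*$-homomorphism $\rho$ from $\mathcal T_u(P)$ (respectively $\mathcal T_\lambda(P)$) to a unital $\mathrm C^*$-algebra $B$ is called jointly proper if $$\prod_{\alpha\in F}\bigl(1-\rho(\dot t_\alpha)\bigr)\neq 0\qquad\Bigl(\text{respectively }\prod_{\alpha\in F}\bigl(1-\rho(\dot L_\alpha)\bigr)\neq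 0\Bigr)$$ for every (possibly empty) finite set $F$ of neutral words such that $K(\alpha)$ is a proper constructible right ideal for each $\alpha\in F$. Then: 1. A unital $*$-homomorphism $\rho\colon\mathcal T_u(P)\to B$ into a unital $\mathrm C^*$-algebra $B$ is injective on $D_u$ if and only if it is jointly proper. 2. $\lambda^+$ restricts to a $*$-isomorphism of $D_u$ onto $D_r$. 3. A unital $*$-homomorphism $\rho\colon\mathcal T_\lambda(P)\to B$ into a unital $\mathrm C^*$-algebra $B$ is injective on $D_r$ if and only if it is jointly proper. -/

import Mathlib

universe u v

namespace ToeplitzSemigroup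

open scoped ENNReal

/-! ### Words, quotient sets and constructible right ideals -/

/-- Words of even length in `P`; the list `[(p₁, p₂), (p₃, p₄), …, (p₂ₖ₋₁, p₂ₖ)]` stands for the
word `(p₁, p₂, …, p₂ₖ)`. -/
abbrev Word {G : Type u} [Group G] (P : Submonoid G) : Type u := List (P × P)

/-- The generalized left quotient `p₁⁻¹ p₂ ⋯ p₂ₖ₋₁⁻¹ p₂ₖ ∈ G` of a word. -/
def quot {G : Type u} [Group G] {P : Submonoid G} (α : Word P) : G :=
  (α.map fun a => (a.1 : G)⁻¹ * (a.2 : G)).prod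

/-- A word is neutral if its quotient is the identity of `G`. -/
def Neutral {G : Type u} [Group G] {P : Submonoid G} (α : Word P) : Prop := quot α = 1

/-- The iterated quotient set
`{e, p₂ₖ⁻¹ p₂ₖ₋₁, p₂ₖ⁻¹ p₂ₖ₋₁ p₂ₖ₋₂⁻¹ p₂ₖ₋₃, …, p₂ₖ⁻¹ p₂ₖ₋₁ ⋯ p₂⁻¹ p₁}`: its elements are the
inverses of the quotients of the final segments of the word. -/
def quotSet {G : Type u} [Group G] {P : Submonoid G} : Word P → Set G
  | [] => {1}
  | a :: α => insert (quot (a :: α))⁻¹ (quotSet α)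

/-- The constructible right ideal `K(α) = ⋂ g P`, over `g` in the iterated quotient set of `α`,
as a subset of `P`. -/
def K {G : Type u} [Group G] {P : Submonoid G} (α : Word P) : Set P :=
  {x | ∀ g ∈ quotSet α, ∃ y : P, (x : G) = g * y}

/-- The alternating product `w_{p₁}^* w_{p₂} ⋯ w_{p₂ₖ₋₁}^* w_{p₂ₖ}`. -/
def wordProd {G : Type u} [Group G] {P : Submonoid G} {B : Type v} [Ring B] [StarRing B]
    (w : P → B) (α : Word P) : B :=
  (α.map fun a => star (w a.1) * w a.2).prod

/-- The relations (T1)–(T4). In (T4) the finite family `F` is nonempty and is listed in some order;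
by (T3) the factors commute, so that neither the order nor repetitions matter. -/
structure IsToeplitzFamily {G : Type u} [Group G] {P : Submonoid G} {B : Type v} [Ring B]
    [StarRing B] (w : P → B) : Prop where
  T1 : w 1 = 1
  T2 : ∀ α : Word P, Neutral α → K α = ∅ → wordProd w α = 0
  T3 : ∀ α β : Word P, Neutral α → Neutral β → K α = K β → wordProd w α = wordProd w β
  T4 : ∀ (α : Word P) (F : List (Word P)), Neutral α → (∀ β ∈ F, Neutral β) → F ≠ [] →
    K α = ⋃ β ∈ F, K β → (F.map fun β => wordProd w α - wordProd w β).prod = 0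

/-- Let `s : P → A` satisfy (T1)–(T4). A unital `*`-homomorphism `ρ` on `A` is jointly proper (with
respect to `s`) if `∏ (1 - ρ(ṡ_α)) ≠ 0` for every finite family of neutral words whose
constructible ideals are proper. The family may be empty, it is listed in some order, and the
factors commute. -/
def JointlyProper {G : Type u} [Group G] {P : Submonoid G} {A : Type*} [Ring A] [StarRing A]
    [Algebra ℂ A] {B : Type v} [Ring B] [StarRing B] [Algebra ℂ B] (s : P → A)
    (ρ : A →⋆ₐ[ℂ] B) : Prop :=
  ∀ F : List (Word P), (∀ α ∈ F, Neutral α ∧ K α ≠ Set.univ) →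
    (F.map fun α => 1 - ρ (wordProd s α)).prod ≠ 0

section Basic

variable {G : Type u} [Group G] {P : Submonoid G}

@[simp] theorem quot_nil : quot ([] : Word P) = 1 := rfl

theorem quot_cons (a : P × P) (α : Word P) :
    quot (a :: α) = (a.1 : G)⁻¹ * (a.2 : G) * quot α := by simp [quot]

theorem quot_append (α β : Word P) : quot (α ++ β) = quot α * quot β := by simp [quot]

/-- The reverse word `(p₂ₖ, p₂ₖ₋₁, …, p₂, p₁)`. -/
def rev (α : Word P) : Word P := (α.map Prod.swap).reverse

theorem quot_rev (α : Word P) : quot (rev α) = (quot α)⁻¹ := by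
  simp only [quot, rev, List.prod_inv_reverse, List.map_reverse, List.map_map]
  congr 3
  funext a
  simp

theorem K_nil : K ([] : Word P) = Set.univ := by
  ext x
  simp [K, quotSet]

theorem mem_K_cons (a : P × P) (α : Word P) (x : P) :
    x ∈ K (a :: α) ↔ x ∈ K α ∧ ∃ y : P, (a.2 : G) * (quot α * x) = a.1 * y := by
  have h : (∃ y : P, (x : G) = (quot (a :: α))⁻¹ * y) ↔
      ∃ y : P, (a.2 : G) * (quot α * x) = a.1 * y := by
    refine exists_congr fun y => ?_
    rw [eq_inv_mul_iff_mul_eq, quot_cons, mul_assoc, mul_assoc, inv_mul_eq_iff_eq_mul]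
  simp only [K, quotSet, Set.mem_ofPred_eq, Set.forall_mem_insert, h]
  exact and_comm

variable {B : Type v} [Ring B] [StarRing B]

@[simp] theorem wordProd_nil (w : P → B) : wordProd w [] = 1 := rfl

theorem wordProd_cons (w : P → B) (a : P × P) (α : Word P) :
    wordProd w (a :: α) = star (w a.1) * w a.2 * wordProd w α := by simp [wordProd]

theorem wordProd_append (w : P → B) (α β : Word P) :
    wordProd w (α ++ β) = wordProd w α * wordProd w β := by simp [wordProd]

theorem star_wordProd (w : P → B) (α : Word P) : star (wordProd w α) = wordProd w (rev α) := by
  induction α with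
  | nil => simp [rev]
  | cons a α ih =>
    rw [wordProd_cons, star_mul, ih]
    simp [rev, wordProd]

theorem map_wordProd [Algebra ℂ B] {A : Type*} [Ring A] [StarRing A] [Algebra ℂ A]
    (φ : A →⋆ₐ[ℂ] B) (w : P → A) (α : Word P) :
    φ (wordProd w α) = wordProd (fun p => φ (w p)) α := by
  induction α with
  | nil => simp
  | cons a α ih => simp [wordProd_cons, ih, map_star]

/-- The relations (T1)–(T4) can be tested along a jointly injective family of homomorphisms. -/
theorem IsToeplitzFamily.of_hom {A : Type*} [Ring A] [StarRing A] [Algebra ℂ A] {ι : Type*}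
    {C : ι → Type*} [∀ i, Ring (C i)] [∀ i, StarRing (C i)] [∀ i, Algebra ℂ (C i)]
    (φ : ∀ i, A →⋆ₐ[ℂ] C i) (hφ : ∀ a b : A, (∀ i, φ i a = φ i b) → a = b) (w : P → A)
    (hw : ∀ i, IsToeplitzFamily fun p => φ i (w p)) : IsToeplitzFamily w where
  T1 := hφ _ _ fun i => by rw [map_one]; exact (hw i).T1
  T2 α hα hK := hφ _ _ fun i => by rw [map_zero, map_wordProd]; exact (hw i).T2 α hα hK
  T3 α β hα hβ hK := hφ _ _ fun i => by
    rw [map_wordProd, map_wordProd]; exact (hw i).T3 α β hα hβ hK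
  T4 α F hα hF hne hK := hφ _ _ fun i => by
    rw [map_zero, map_list_prod, List.map_map, ← (hw i).T4 α F hα hF hne hK]
    congr 2
    funext β
    simp [map_wordProd]

theorem IsToeplitzFamily.star_mul_self {w : P → B} (hw : IsToeplitzFamily w) (p : P) :
    star (w p) * w p = 1 := by
  have h : wordProd w [(p, p)] = wordProd w [] := by
    refine hw.T3 _ _ (by simp [Neutral, quot]) (by simp [Neutral]) ?_
    ext x
    simp only [mem_K_cons, K_nil, Set.mem_univ, true_and, iff_true, quot_nil, one_mul]
    exact ⟨x, rfl⟩
  simpa [wordProd] using h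

end Basic

/-! ### Diagonals -/

/-- The closed linear span of the elements `ẇ_α`, `α` a neutral word. It is a `*`-subalgebra, as
`ẇ_α ẇ_β = ẇ_{αβ}` and `ẇ_α^* = ẇ_{α̃}`. -/
noncomputable def diagonal {G : Type u} [Group G] {P : Submonoid G} {A : Type v} [CStarAlgebra A]
    (w : P → A) : StarSubalgebra ℂ A where
  carrier := closure (Submodule.span ℂ {a | ∃ α : Word P, Neutral α ∧ a = wordProd w α} : Set A)
  mul_mem' {a b} ha hb := by
    refine map_mem_closure₂ continuous_mul ha hb fun x hx y hy => ?_
    refine Submodule.span_induction (p := fun x _ => x * y ∈ Submodule.span ℂ _)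
      ?_ ?_ ?_ ?_ hx
    · rintro _ ⟨α, hα, rfl⟩
      refine Submodule.span_induction (p := fun y _ => wordProd w α * y ∈ Submodule.span ℂ _)
        ?_ ?_ ?_ ?_ hy
      · rintro _ ⟨β, hβ, rfl⟩
        refine Submodule.subset_span ⟨α ++ β, ?_, (wordProd_append w α β).symm⟩
        unfold Neutral at *
        rw [quot_append, hα, hβ, one_mul]
      · simp
      · intro y z _ _ hy hz
        rw [mul_add]
        exact Submodule.add_mem _ hy hz
      · intro c y _ hy
        rw [mul_smul_comm]
        exact Submodule.smul_mem _ c hy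
    · simp
    · intro y z _ _ hy hz
      rw [add_mul]
      exact Submodule.add_mem _ hy hz
    · intro c y _ hy
      rw [smul_mul_assoc]
      exact Submodule.smul_mem _ c hy
  add_mem' {a b} ha hb :=
    map_mem_closure₂ continuous_add ha hb fun _ hx _ hy => Submodule.add_mem _ hx hy
  algebraMap_mem' c := by
    refine subset_closure ?_
    rw [Algebra.algebraMap_eq_smul_one]
    exact Submodule.smul_mem _ c (Submodule.subset_span ⟨[], rfl, rfl⟩)
  star_mem' {a} ha := by
    refine map_mem_closure continuous_star ha fun x hx => ?_
    refine Submodule.span_induction (p := fun x _ => star x ∈ Submodule.span ℂ _)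
      ?_ ?_ ?_ ?_ hx
    · rintro _ ⟨α, hα, rfl⟩
      refine Submodule.subset_span ⟨rev α, ?_, star_wordProd w α⟩
      unfold Neutral at *
      rw [quot_rev, hα, inv_one]
    · simp
    · intro y z _ _ hy hz
      rw [star_add]
      exact Submodule.add_mem _ hy hz
    · intro c y _ hy
      rw [star_smul]
      exact Submodule.smul_mem _ _ hy

/-! ### The `C^*`-algebra generated by a family -/

/-- The unital `C^*`-subalgebra generated by the elements `w p`. -/
noncomputable def generated {G : Type u} [Group G] {P : Submonoid G} {A : Type v} [CStarAlgebra A]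
    (w : P → A) : StarSubalgebra ℂ A :=
  (StarAlgebra.adjoin ℂ (Set.range w)).topologicalClosure

noncomputable instance {G : Type u} [Group G] {P : Submonoid G} {A : Type v} [CStarAlgebra A]
    (w : P → A) : CStarAlgebra (generated w) :=
  StarSubalgebra.cstarAlgebra (generated w)
    (h_closed := (StarAlgebra.adjoin ℂ (Set.range w)).isClosed_topologicalClosure)

theorem mem_generated {G : Type u} [Group G] {P : Submonoid G} {A : Type v} [CStarAlgebra A]
    (w : P → A) (p : P) : w p ∈ generated w :=
  StarSubalgebra.le_topologicalClosure _ (StarAlgebra.subset_adjoin ℂ _ ⟨p, rfl⟩)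

/-! ### The universal Toeplitz algebra -/

/-- A nonzero unital `C^*`-algebra together with a family satisfying (T1)–(T4). The `C^*`-algebra
lives in the universe of `G`; this is no restriction for the universal object below, because the
`C^*`-algebra generated by a family indexed by `P` has at most `(ℵ₀ + |P|) ^ ℵ₀` elements and so is
isomorphic to one in that universe (and homomorphisms into the zero algebra need no coordinate). -/
structure ToeplitzRep {G : Type u} [Group G] (P : Submonoid G) : Type (u + 1) where
  carrier : Type u
  [cstar : CStarAlgebra carrier]
  [nontrivial : Nontrivial carrier]
  w : P → carrier
  isToeplitz : IsToeplitzFamily w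

attribute [instance] ToeplitzRep.cstar ToeplitzRep.nontrivial

/-- The `ℓ^∞`-product of the `C^*`-algebras of all families satisfying (T1)–(T4). -/
abbrev Product {G : Type u} [Group G] (P : Submonoid G) : Type (u + 1) :=
  lp (fun i : ToeplitzRep P => i.carrier) ∞

noncomputable instance {G : Type u} [Group G] (P : Submonoid G) : CStarAlgebra (Product P) where

/-- The family in the product whose coordinates are all the families satisfying (T1)–(T4). -/
noncomputable def productFamily {G : Type u} [Group G] (P : Submonoid G) (p : P) : Product P :=
  ⟨fun i => i.w p, memℓp_infty ⟨1, by
    rintro _ ⟨i, rfl⟩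
    have h := CStarRing.norm_star_mul_self (x := i.w p)
    rw [i.isToeplitz.star_mul_self p, norm_one] at h
    nlinarith [norm_nonneg (i.w p)]⟩⟩

/-- The universal Toeplitz algebra `𝒯_u(P)`: the universal unital `C^*`-algebra generated by a
family satisfying (T1)–(T4), realized as the `C^*`-algebra generated by the direct sum of all such
families. -/
abbrev UniversalToeplitz {G : Type u} [Group G] (P : Submonoid G) : Type (u + 1) :=
  generated (productFamily P)

/-- The canonical generators `t_p` of `𝒯_u(P)`. -/
noncomputable def t {G : Type u} [Group G] (P : Submonoid G) (p : P) : UniversalToeplitz P :=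
  ⟨productFamily P p, mem_generated _ p⟩

/-- The `i`-th coordinate as a `*`-homomorphism. -/
noncomputable def coord {G : Type u} [Group G] {P : Submonoid G} (i : ToeplitzRep P) :
    Product P →⋆ₐ[ℂ] i.carrier where
  toFun f := f i
  map_one' := rfl
  map_mul' _ _ := rfl
  map_zero' := rfl
  map_add' _ _ := rfl
  commutes' _ := rfl
  map_star' _ := rfl

theorem isToeplitzFamily_t {G : Type u} [Group G] (P : Submonoid G) :
    IsToeplitzFamily (t P) :=
  IsToeplitzFamily.of_hom
    (fun i : ToeplitzRep P => (coord i).comp (generated (productFamily P)).subtype)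
    (fun _ _ h => Subtype.ext (lp.ext (funext h))) (t P) fun i => i.isToeplitz

/-- The homomorphism out of `𝒯_u(P)` given by the universal property. -/
noncomputable def lift {G : Type u} [Group G] {P : Submonoid G} {B : Type u} [CStarAlgebra B]
    [Nontrivial B] (w : P → B) (hw : IsToeplitzFamily w) : UniversalToeplitz P →⋆ₐ[ℂ] B :=
  (coord (⟨B, w, hw⟩ : ToeplitzRep P)).comp (generated (productFamily P)).subtype

theorem lift_t {G : Type u} [Group G] {P : Submonoid G} {B : Type u} [CStarAlgebra B]
    [Nontrivial B] (w : P → B) (hw : IsToeplitzFamily w) (p : P) : lift w hw (t P p) = w p := rfl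

/-- The full diagonal `D_u`: the closed span of the `ṫ_α`, `α` neutral. -/
noncomputable def fullDiagonal {G : Type u} [Group G] (P : Submonoid G) :
    StarSubalgebra ℂ (UniversalToeplitz P) :=
  diagonal (t P)

/-! ### The reduced Toeplitz algebra -/

/-- The Hilbert space `ℓ²(P)`. -/
abbrev ell2 {G : Type u} [Group G] (P : Submonoid G) : Type u := lp (fun _ : P => ℂ) 2

/-- The standard orthonormal basis `(δ_x)` of `ℓ²(P)`. -/
noncomputable def delta {G : Type u} [Group G] (P : Submonoid G) : HilbertBasis P ℂ (ell2 P) :=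
  ⟨LinearIsometryEquiv.refl ℂ (ell2 P)⟩

theorem orthonormal_delta_mul {G : Type u} [Group G] {P : Submonoid G} (p : P) :
    Orthonormal ℂ fun q => delta P (p * q) :=
  (delta P).orthonormal.comp _ (mul_right_injective p)

/-- The left regular representation: `L_p` is the isometry of `ℓ²(P)` with `L_p δ_q = δ_{pq}`. -/
noncomputable def L {G : Type u} [Group G] {P : Submonoid G} (p : P) : ell2 P →L[ℂ] ell2 P :=
  (orthonormal_delta_mul p).orthogonalFamily.linearIsometry.toContinuousLinearMap

/-- The reduced Toeplitz algebra `𝒯_λ(P)`: the `C^*`-algebra generated by the `L_p`. -/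
abbrev ReducedToeplitz {G : Type u} [Group G] (P : Submonoid G) : Type u :=
  generated (L : P → ell2 P →L[ℂ] ell2 P)

/-- The isometries `L_p` as elements of `𝒯_λ(P)`. -/
noncomputable def l {G : Type u} [Group G] (P : Submonoid G) (p : P) : ReducedToeplitz P :=
  ⟨L p, mem_generated _ p⟩

/-- The reduced diagonal `D_r`: the closed span of the elements `L̇_α`, `α` neutral. By
`wordProd_L_delta` below, `L̇_α` is multiplication by the characteristic function of `K(α)`. -/
noncomputable def reducedDiagonal {G : Type u} [Group G] (P : Submonoid G) :
    StarSubalgebra ℂ (ReducedToeplitz P) :=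
  diagonal (l P)

section Reduced

variable {G : Type u} [Group G] {P : Submonoid G}

theorem L_delta (p q : P) : L p (delta P q) = delta P (p * q) := by
  classical
  have h := (orthonormal_delta_mul p).orthogonalFamily.linearIsometry_apply_single
    (i := q) (1 : ℂ)
  have e : delta P q = lp.single 2 q (1 : ℂ) := by
    rw [← (delta P).repr_symm_single]; rfl
  rw [e]
  exact h.trans (one_smul ℂ _)

theorem delta_ext {S T : ell2 P →L[ℂ] ell2 P} (h : ∀ x, S (delta P x) = T (delta P x)) :
    S = T := by
  refine ContinuousLinearMap.ext_on (s := Set.range (delta P)) ?_ ?_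
  · rw [dense_iff_closure_eq, ← Submodule.topologicalClosure_coe, (delta P).dense_span]
    rfl
  · rintro _ ⟨x, rfl⟩
    exact h x

theorem inner_delta_ext {a b : ell2 P} (h : ∀ z, inner ℂ (delta P z) a = inner ℂ (delta P z) b) :
    a = b := by
  refine (delta P).repr.injective (lp.ext (funext fun z => ?_))
  rw [(delta P).repr_apply_apply, (delta P).repr_apply_apply, h]

theorem star_L_delta_mul (p x : P) : star (L p) (delta P (p * x)) = delta P x := by
  refine inner_delta_ext fun z => ?_
  rw [ContinuousLinearMap.star_eq_adjoint, ContinuousLinearMap.adjoint_inner_right, L_delta]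
  classical
  rw [orthonormal_iff_ite.mp (delta P).orthonormal, orthonormal_iff_ite.mp (delta P).orthonormal]
  simp

theorem star_L_delta_of_notMem (p y : P) (h : ∀ x, y ≠ p * x) : star (L p) (delta P y) = 0 := by
  refine inner_delta_ext fun z => ?_
  rw [ContinuousLinearMap.star_eq_adjoint, ContinuousLinearMap.adjoint_inner_right, L_delta]
  classical
  rw [orthonormal_iff_ite.mp (delta P).orthonormal, if_neg (fun e => h z e.symm), inner_zero_right]

theorem wordProd_L_delta_aux (α : Word P) (x : P) :
    (x ∈ K α → ∃ y : P, (y : G) = quot α * x ∧ wordProd L α (delta P x) = delta P y) ∧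
      (x ∉ K α → wordProd L α (delta P x) = 0) := by
  induction α with
  | nil => exact ⟨fun _ => ⟨x, by simp, rfl⟩, fun h => absurd (by simp [K_nil]) h⟩
  | cons a α ih =>
    have hc : wordProd L (a :: α) (delta P x)
        = star (L a.1) (L a.2 (wordProd L α (delta P x))) := by
      rw [wordProd_cons]; rfl
    by_cases hx : x ∈ K α
    · obtain ⟨y, hy, hw⟩ := ih.1 hx
      rw [hw, L_delta] at hc
      constructor
      · intro h
        obtain ⟨z, hz⟩ := ((mem_K_cons a α x).1 h).2
        have e : a.2 * y = a.1 * z := Subtype.ext (by simpa [hy] using hz)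
        refine ⟨z, ?_, by rw [hc, e, star_L_delta_mul]⟩
        rw [quot_cons, mul_assoc, mul_assoc, hz, inv_mul_cancel_left]
      · intro h
        rw [hc]
        refine star_L_delta_of_notMem _ _ fun z e => h ((mem_K_cons a α x).2 ⟨hx, z, ?_⟩)
        rw [← hy]
        exact congrArg Subtype.val e
    · refine ⟨fun h => absurd ((mem_K_cons a α x).1 h).1 hx, fun _ => ?_⟩
      rw [hc, ih.2 hx, map_zero, map_zero]

open Classical in
/-- For a neutral word, `L̇_α` is multiplication by the characteristic function of `K(α)`. -/
theorem wordProd_L_delta (α : Word P) (hα : Neutral α) (x : P) :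
    wordProd L α (delta P x) = (if x ∈ K α then (1 : ℂ) else 0) • delta P x := by
  split_ifs with h
  · obtain ⟨y, hy, hw⟩ := (wordProd_L_delta_aux α x).1 h
    unfold Neutral at hα
    rw [hα, one_mul] at hy
    rw [hw, Subtype.ext hy, one_smul]
  · rw [(wordProd_L_delta_aux α x).2 h, zero_smul]

theorem isToeplitzFamily_L : IsToeplitzFamily (L : P → ell2 P →L[ℂ] ell2 P) where
  T1 := delta_ext fun x => by rw [L_delta, one_mul]; rfl
  T2 α hα hK := delta_ext fun x => by simp [wordProd_L_delta α hα, hK]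
  T3 α β hα hβ hK := delta_ext fun x => by
    rw [wordProd_L_delta α hα, wordProd_L_delta β hβ, hK]
  T4 α F hα hF hne hK := delta_ext fun x => by
    classical
    let c : Word P → ℂ := fun β => (if x ∈ K α then 1 else 0) - (if x ∈ K β then 1 else 0)
    have key : ∀ F : List (Word P), (∀ β ∈ F, Neutral β) →
        (F.map fun β => wordProd L α - wordProd L β).prod (delta P x)
          = (F.map c).prod • delta P x := by
      intro F
      induction F with
      | nil => intro _; simp
      | cons β F ih =>
        intro hF
        have h1 := ih fun γ hγ => hF γ (List.mem_cons_of_mem _ hγ)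
        have h2 := hF β List.mem_cons_self
        rw [List.map_cons, List.prod_cons, List.map_cons, List.prod_cons,
          mul_apply_eq_comp, h1, map_smul, sub_apply,
          wordProd_L_delta α hα, wordProd_L_delta β h2, ← sub_smul, smul_smul, mul_comm]
    have hz : (F.map c).prod = 0 := by
      rw [List.prod_eq_zero_iff, List.mem_map]
      by_cases hx : x ∈ K α
      · have hx' := hx
        rw [hK] at hx'
        simp only [Set.mem_iUnion] at hx'
        obtain ⟨β, hβ, h⟩ := hx'
        exact ⟨β, hβ, by simp [c, hx, h]⟩
      · obtain ⟨β, hβ⟩ := List.exists_mem_of_ne_nil F hne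
        refine ⟨β, hβ, ?_⟩
        have h : x ∉ K β := fun h => hx (by
          rw [hK]
          simp only [Set.mem_iUnion]
          exact ⟨β, hβ, h⟩)
        simp [c, hx, h]
    rw [key F hF, hz, zero_smul]
    rfl

theorem isToeplitzFamily_l : IsToeplitzFamily (l P) :=
  IsToeplitzFamily.of_hom (ι := Unit)
    (fun _ => (generated (L : P → ell2 P →L[ℂ] ell2 P)).subtype)
    (fun _ _ h => Subtype.ext (h ())) (l P) fun _ => isToeplitzFamily_L

instance : Nontrivial (ReducedToeplitz P) := by
  refine ⟨⟨1, 0, fun h => ?_⟩⟩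
  have h1 : (1 : ell2 P →L[ℂ] ell2 P) = 0 := congrArg Subtype.val h
  have h2 := congrArg (fun T : ell2 P →L[ℂ] ell2 P => T (delta P 1)) h1
  exact (delta P).orthonormal.ne_zero 1 h2

end Reduced

/-- The canonical homomorphism `λ⁺ : 𝒯_u(P) → 𝒯_λ(P)`, determined by `t_p ↦ L_p`. -/
noncomputable def lambdaPlus {G : Type u} [Group G] (P : Submonoid G) :
    UniversalToeplitz P →⋆ₐ[ℂ] ReducedToeplitz P :=
  lift (l P) isToeplitzFamily_l

theorem lambdaPlus_t {G : Type u} [Group G] (P : Submonoid G) (p : P) :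
    lambdaPlus P (t P p) = l P p := rfl

end ToeplitzSemigroup

/-! For any family satisfying (T1)–(T4), the norm of `∑ c_α ẇ_α` over neutral words is compared with
the supremum over `P` of `|∑ c_α 1_{K(α)}|`.

Upper bound (`norm_diagSum_le`): the diagonal is commutative, so Gelfand theory computes norms
through characters. By (T2) and (T4) a character agrees, on any finite set of neutral words, with
evaluation at a point of `P` (`exists_mem_K_iff`).

Lower bound (`norm_symbol_le`), under joint properness: compressing by `w_x` replaces `K(α)` by
`x⁻¹K(α)`, which is `P` if `x ∈ K(α)` and proper otherwise. The product of `1 - ẇ` over the proper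
ones is nonzero, and on it the compressed sum acts as the scalar `∑ c_α 1_{K(α)}(x)`.

Hence a jointly proper `ρ` is isometric on the diagonal. Conversely, in the regular representation
`δ_e` is fixed by every `1 - L̇_α` with `K(α)` proper, so the products do not vanish there. They are
therefore nonzero in both Toeplitz algebras, and a homomorphism injective on the diagonal cannot
kill them. The same vector shows that `λ⁺` is jointly proper, which gives the isomorphism of
diagonals. -/

namespace ToeplitzSemigroup

/-! ### Neutral words and their constructible ideals -/

section Words

variable {G : Type u} [Group G] {P : Submonoid G}

theorem Neutral.nil : Neutral ([] : Word P) := rfl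

theorem Neutral.append {α β : Word P} (hα : Neutral α) (hβ : Neutral β) : Neutral (α ++ β) := by
  unfold Neutral at *
  rw [quot_append, hα, hβ, one_mul]

theorem Neutral.flatten {F : List (Word P)} (hF : ∀ α ∈ F, Neutral α) : Neutral F.flatten := by
  induction F with
  | nil => exact Neutral.nil
  | cons α F ih =>
    exact (hF α List.mem_cons_self).append (ih fun β hβ => hF β (List.mem_cons_of_mem _ hβ))

/-- Constructible right ideals are right ideals. -/
theorem mul_mem_K {α : Word P} {x : P} (hx : x ∈ K α) (y : P) : x * y ∈ K α := by
  intro g hg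
  obtain ⟨z, hz⟩ := hx g hg
  exact ⟨z * y, by simp [hz, mul_assoc]⟩

theorem K_eq_univ_iff {α : Word P} : K α = Set.univ ↔ (1 : P) ∈ K α :=
  ⟨fun h => h ▸ Set.mem_univ _, fun h => Set.eq_univ_of_forall fun x => by
    simpa using mul_mem_K h x⟩

/-- Appending `β` shifts the conditions coming from `α` by `quot β`, which is trivial here. With
(T3), this makes the `ẇ_α` commuting idempotents. -/
theorem K_append (α : Word P) {β : Word P} (hβ : Neutral β) : K (α ++ β) = K α ∩ K β := by
  induction α with
  | nil => simp [K_nil]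
  | cons a α ih =>
    ext x
    rw [List.cons_append, mem_K_cons, ih, Set.mem_inter_iff, Set.mem_inter_iff, mem_K_cons,
      quot_append, show quot β = 1 from hβ, mul_one]
    tauto

theorem mem_K_flatten {F : List (Word P)} (hF : ∀ α ∈ F, Neutral α) (x : P) :
    x ∈ K F.flatten ↔ ∀ α ∈ F, x ∈ K α := by
  induction F with
  | nil => simp [K_nil]
  | cons α F ih =>
    have hF' : ∀ β ∈ F, Neutral β := fun β hβ => hF β (List.mem_cons_of_mem _ hβ)
    rw [List.flatten_cons, K_append α (Neutral.flatten hF'), Set.mem_inter_iff, ih hF',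
      List.forall_mem_cons]

/-- The word `(x, e) α (e, x)`, whose constructible ideal is `x⁻¹ K(α)` if `α` is neutral. -/
def conj (x : P) (α : Word P) : Word P := (x, 1) :: (α ++ [(1, x)])

theorem Neutral.conj {α : Word P} (hα : Neutral α) (x : P) : Neutral (conj x α) := by
  unfold Neutral ToeplitzSemigroup.conj at *
  rw [quot_cons, quot_append, hα]
  simp [quot]

theorem mem_K_append_singleton (α : Word P) (x y : P) : y ∈ K (α ++ [(1, x)]) ↔ x * y ∈ K α := by
  induction α with
  | nil =>
    rw [List.nil_append, mem_K_cons]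
    simpa [K_nil] using (x * y).2
  | cons a α ih =>
    rw [List.cons_append, mem_K_cons, mem_K_cons, ih, quot_append]
    simp [quot, mul_assoc]

/-- The leading pair `(x, e)` only asks that `xy` lie in `xP`, because `α` is neutral. Taking `y =
e` shows that the ideal is all of `P` exactly when `x ∈ K α`. -/
theorem mem_K_conj {α : Word P} (hα : Neutral α) (x y : P) : y ∈ K (conj x α) ↔ x * y ∈ K α := by
  rw [conj, mem_K_cons, mem_K_append_singleton, and_iff_left_iff_imp]
  refine fun _ => ⟨y, ?_⟩
  rw [quot_append, show quot α = 1 from hα]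
  simp [quot]

end Words

/-! ### Algebraic consequences of the relations; characters of the diagonal -/

section Family

variable {G : Type u} [Group G] {P : Submonoid G} {A : Type*} [Ring A] [StarRing A]

theorem wordProd_conj {w : P → A} (hw : w 1 = 1) (x : P) (α : Word P) :
    wordProd w (conj x α) = star (w x) * wordProd w α * w x := by
  rw [conj, wordProd_cons, wordProd_append, wordProd_cons, hw]
  simp [mul_assoc]

namespace IsToeplitzFamily

theorem wordProd_of_K_eq_univ {w : P → A} (hw : IsToeplitzFamily w) {α : Word P} (hα : Neutral α)
    (h : K α = Set.univ) : wordProd w α = 1 :=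
  hw.T3 α [] hα Neutral.nil (h.trans K_nil.symm)

theorem commute {w : P → A} (hw : IsToeplitzFamily w) {α β : Word P} (hα : Neutral α)
    (hβ : Neutral β) : Commute (wordProd w α) (wordProd w β) := by
  rw [commute_iff_eq, ← wordProd_append, ← wordProd_append]
  exact hw.T3 _ _ (hα.append hβ) (hβ.append hα)
    (by rw [K_append α hβ, K_append β hα, Set.inter_comm])

theorem isIdempotentElem {w : P → A} (hw : IsToeplitzFamily w) {α : Word P} (hα : Neutral α) :
    IsIdempotentElem (wordProd w α) := by
  rw [IsIdempotentElem, ← wordProd_append]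
  exact hw.T3 _ _ (hα.append hα) hα (by rw [K_append α hα, Set.inter_self])

theorem wordProd_mul_prod_one_sub {w : P → A} (hw : IsToeplitzFamily w) {F : List (Word P)}
    (hF : ∀ α ∈ F, Neutral α) {β : Word P} (hβ : β ∈ F) :
    wordProd w β * (F.map fun α => 1 - wordProd w α).prod = 0 := by
  induction F with
  | nil => simp at hβ
  | cons γ F ih =>
    rw [List.map_cons, List.prod_cons, ← mul_assoc]
    rcases List.mem_cons.1 hβ with rfl | h
    · rw [(hw.isIdempotentElem (hF β hβ)).mul_one_sub_self, zero_mul]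
    · have hc : Commute (wordProd w β) (1 - wordProd w γ) :=
        (Commute.one_right _).sub_right (hw.commute (hF β hβ) (hF γ List.mem_cons_self))
      rw [hc.eq, mul_assoc, ih (fun α hα => hF α (List.mem_cons_of_mem _ hα)) h, mul_zero]

theorem map {B : Type*} [Ring B] [StarRing B] [Algebra ℂ A] [Algebra ℂ B] {w : P → A}
    (hw : IsToeplitzFamily w) (ρ : A →⋆ₐ[ℂ] B) : IsToeplitzFamily fun p => ρ (w p) where
  T1 := by rw [hw.T1, map_one]
  T2 α hα hK := by rw [← map_wordProd, hw.T2 α hα hK, map_zero]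
  T3 α β hα hβ hK := by rw [← map_wordProd, ← map_wordProd, hw.T3 α β hα hβ hK]
  T4 α F hα hF hne hK := by
    rw [← map_zero ρ, ← hw.T4 α F hα hF hne hK, map_list_prod, List.map_map]
    congr 2
    funext β
    simp [map_wordProd]

/-- A character of the diagonal restricts on finitely many words to evaluation at a point. -/
theorem exists_mem_K_iff {w : P → A} (hw : IsToeplitzFamily w) {D : Type*} [Ring D] (i : D →+* A)
    (hi : Function.Injective i) (d : {α : Word P // Neutral α} → D)
    (hd : ∀ α, i (d α) = wordProd w α) {k : Type*} [Field k] (χ : D →+* k)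
    (S : List {α : Word P // Neutral α}) :
    ∃ x : P, ∀ α ∈ S, (x ∈ K α.1 ∧ χ (d α) = 1) ∨ (x ∉ K α.1 ∧ χ (d α) = 0) := by
  classical
  have hdich : ∀ α, χ (d α) = 0 ∨ χ (d α) = 1 := fun α => by
    refine IsIdempotentElem.iff_eq_zero_or_one.1 ?_
    rw [IsIdempotentElem, ← map_mul]
    congr 1
    refine hi ?_
    rw [map_mul, hd]
    exact hw.isIdempotentElem α.2
  have happ : ∀ α β, χ (d ⟨α.1 ++ β.1, α.2.append β.2⟩) = χ (d α) * χ (d β) := fun α β => by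
    rw [← map_mul]
    congr 1
    refine hi ?_
    rw [map_mul, hd, hd, hd, wordProd_append]
  -- Now every `x` is separated from `χ` by some `α ∈ S`. This turns into a covering of an ideal on
  -- which `χ` is 1 by ideals on which it is 0.
  by_contra! hcon
  set S₁ := S.filter fun α => χ (d α) = 1 with hS₁
  set S₀ := S.filter fun α => χ (d α) = 0 with hS₀
  have hn : ∀ α ∈ S₁.map Subtype.val, Neutral α := by
    simp only [List.mem_map]
    rintro _ ⟨α, _, rfl⟩
    exact α.2
  -- `K γ` is the intersection of the ideals on which `χ` takes the value 1.
  let γ : {α : Word P // Neutral α} := ⟨(S₁.map Subtype.val).flatten, Neutral.flatten hn⟩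
  have hγ : χ (d γ) = 1 := by
    have aux : ∀ (T : List {α : Word P // Neutral α}) (h : Neutral (T.map Subtype.val).flatten),
        (∀ α ∈ T, χ (d α) = 1) → χ (d ⟨(T.map Subtype.val).flatten, h⟩) = 1 := by
      intro T
      induction T with
      | nil =>
        intro h _
        rw [← map_one χ]
        congr 1
        exact hi (by rw [hd, map_one]; rfl)
      | cons α T ih =>
        intro h hT
        have hT' : Neutral (T.map Subtype.val).flatten := Neutral.flatten (by
          simp only [List.mem_map]
          rintro _ ⟨α, _, rfl⟩
          exact α.2)
        exact (happ α ⟨_, hT'⟩).trans (by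
          rw [hT α List.mem_cons_self, ih hT' fun β hβ => hT β (List.mem_cons_of_mem _ hβ),
            one_mul])
    exact aux S₁ _ fun α hα => by simpa using (List.mem_filter.1 hα).2
  -- A point of `K γ` agrees with `χ` on `S₁`, so the word separating it from `χ` lies in `S₀` and
  -- its ideal contains the point. Appending to `γ` cuts these ideals down to subsets of `K γ`, as
  -- (T4) requires.
  have hK : K γ.1 = ⋃ β ∈ S₀.map fun α => γ.1 ++ α.1, K β := by
    ext x
    simp only [Set.mem_iUnion, List.mem_map, exists_prop]
    constructor
    · intro hx
      obtain ⟨α, hα, h1, h0⟩ := hcon x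
      have hx' := (mem_K_flatten hn x).1 hx
      rcases hdich α with h | h
      · refine ⟨_, ⟨α, List.mem_filter.2 ⟨hα, by simpa using h⟩, rfl⟩, ?_⟩
        rw [K_append _ α.2]
        refine ⟨hx, ?_⟩
        by_contra hxα
        exact h0 hxα h
      · exact absurd h (h1 (hx' α.1 (List.mem_map_of_mem
          (List.mem_filter.2 ⟨hα, by simpa using h⟩))))
    · rintro ⟨_, ⟨α, _, rfl⟩, hx⟩
      rw [K_append _ α.2] at hx
      exact hx.1
  -- (T4) needs a nonempty family; if `S₀` is empty then so is `K γ`, and (T2) applies.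
  by_cases hne : S₀ = []
  · have h0 : d γ = 0 := hi (by
      rw [hd, map_zero]
      exact hw.T2 _ γ.2 (by rw [hK, hne]; simp))
    rw [h0, map_zero] at hγ
    exact zero_ne_one hγ
  · have h4 := hw.T4 γ.1 (S₀.map fun α => γ.1 ++ α.1) γ.2
      (by
        simp only [List.mem_map]
        rintro _ ⟨α, _, rfl⟩
        exact γ.2.append α.2)
      (fun h => hne (List.map_eq_nil_iff.1 h)) hK
    have h5 : (S₀.map fun α => d γ - d ⟨γ.1 ++ α.1, γ.2.append α.2⟩).prod = 0 := hi (by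
      rw [map_zero, map_list_prod, List.map_map, ← h4, List.map_map]
      congr 2
      funext α
      simp [hd])
    -- Under `χ` every factor becomes `1 - 1 * 0 = 1`, so the product cannot vanish.
    have h6 := congrArg χ h5
    rw [map_zero, map_list_prod, List.map_map, List.prod_eq_zero_iff, List.mem_map] at h6
    obtain ⟨α, hα, h⟩ := h6
    have hα0 : χ (d α) = 0 := by simpa using (List.mem_filter.1 hα).2
    rw [Function.comp_apply, map_sub, happ, hγ, hα0, mul_zero, sub_zero] at h
    exact one_ne_zero h

end IsToeplitzFamily

end Family

/-! ### Norm estimates on the diagonal -/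

section Norm

variable {G : Type u} [Group G] {P : Submonoid G}

/-- The linear combination `∑ c_α ẇ_α`. -/
noncomputable def diagSum {A : Type*} [Ring A] [StarRing A] [Algebra ℂ A] (w : P → A) :
    ({α : Word P // Neutral α} →₀ ℂ) →ₗ[ℂ] A :=
  Finsupp.linearCombination ℂ fun α => wordProd w α.1

open Classical in
/-- The value at `x` of the function `∑ c_α 1_{K(α)}`. -/
noncomputable def symbol (x : P) : ({α : Word P // Neutral α} →₀ ℂ) →ₗ[ℂ] ℂ :=
  Finsupp.linearCombination ℂ fun α => if x ∈ K α.1 then 1 else 0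

theorem map_diagSum {A B : Type*} [Ring A] [StarRing A] [Algebra ℂ A] [Ring B] [StarRing B]
    [Algebra ℂ B] (ρ : A →⋆ₐ[ℂ] B) (w : P → A) (c : {α : Word P // Neutral α} →₀ ℂ) :
    ρ (diagSum w c) = diagSum (fun p => ρ (w p)) c := by
  simp [diagSum, Finsupp.linearCombination_apply, Finsupp.sum, map_wordProd]

variable {A : Type v} [CStarAlgebra A]

theorem coe_diagonal (w : P → A) : (diagonal w : Set A) = closure (Set.range (diagSum w)) := by
  have h : {a | ∃ α : Word P, Neutral α ∧ a = wordProd w α}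
      = Set.range fun α : {α : Word P // Neutral α} => wordProd w α.1 := by
    ext a
    simp [eq_comm]
  change closure ((Submodule.span ℂ {a | ∃ α : Word P, Neutral α ∧ a = wordProd w α} :
    Submodule ℂ A) : Set A) = _
  rw [h, ← Finsupp.range_linearCombination]
  rfl

theorem diagSum_mem_diagonal (w : P → A) (c : {α : Word P // Neutral α} →₀ ℂ) :
    diagSum w c ∈ diagonal w := by
  rw [← SetLike.mem_coe, coe_diagonal]
  exact subset_closure ⟨c, rfl⟩

theorem wordProd_mem_diagonal (w : P → A) {α : Word P} (hα : Neutral α) :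
    wordProd w α ∈ diagonal w := by
  simpa [diagSum] using diagSum_mem_diagonal w (Finsupp.single ⟨α, hα⟩ 1)

theorem isClosed_diagonal (w : P → A) : IsClosed (diagonal w : Set A) := by
  rw [coe_diagonal]
  exact isClosed_closure

theorem IsToeplitzFamily.diagonal_mul_comm {w : P → A} (hw : IsToeplitzFamily w) {a b : A}
    (ha : a ∈ diagonal w) (hb : b ∈ diagonal w) : a * b = b * a := by
  rw [← SetLike.mem_coe, coe_diagonal] at ha hb
  have key : ∀ c d, Commute (diagSum w c) (diagSum w d) := fun c d => by
    simp only [diagSum, Finsupp.linearCombination_apply, Finsupp.sum]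
    exact Commute.sum_left _ _ _ fun α _ => Commute.sum_right _ _ _ fun β _ =>
      ((hw.commute α.2 β.2).smul_left _).smul_right _
  -- The commutator is continuous and vanishes on the dense span.
  have h := map_mem_closure₂ (f := fun a b : A => a * b - b * a) (u := {0}) (by fun_prop) ha hb (by
    rintro _ ⟨c, rfl⟩ _ ⟨d, rfl⟩
    exact sub_eq_zero.2 (key c d))
  rw [closure_singleton] at h
  exact sub_eq_zero.1 h

/-- The diagonal of a family satisfying (T1)–(T4) is a commutative `C^*`-algebra. -/
noncomputable abbrev IsToeplitzFamily.commCStarAlgebra {w : P → A} (hw : IsToeplitzFamily w) :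
    CommCStarAlgebra (diagonal w) :=
  { StarSubalgebra.cstarAlgebra (diagonal w) (h_closed := isClosed_diagonal w) with
    mul_comm := fun a b => Subtype.ext (hw.diagonal_mul_comm a.2 b.2) }

/-- The Gelfand transform is isometric, and each character sends the finite sum to its symbol at
some point of `P`. No joint properness is needed for this direction. -/
theorem IsToeplitzFamily.norm_diagSum_le {w : P → A} (hw : IsToeplitzFamily w)
    (c : {α : Word P // Neutral α} →₀ ℂ) {M : ℝ} (hM : 0 ≤ M) (h : ∀ x, ‖symbol x c‖ ≤ M) :
    ‖diagSum w c‖ ≤ M := by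
  classical
  let := hw.commCStarAlgebra
  let d : {α : Word P // Neutral α} → diagonal w := fun α => ⟨_, wordProd_mem_diagonal w α.2⟩
  let a : diagonal w := ⟨_, diagSum_mem_diagonal w c⟩
  change ‖a‖ ≤ M
  have ha : a = c.sum fun α z => z • d α := Subtype.ext (by
    simp only [a, d, diagSum, Finsupp.linearCombination_apply, Finsupp.sum]
    push_cast
    rfl)
  rw [← (AddMonoidHomClass.isometry_iff_norm _).1 (gelfandTransform_isometry (diagonal w)) a,
    ContinuousMap.norm_le _ hM]
  intro χ
  obtain ⟨x, hx⟩ := hw.exists_mem_K_iff (diagonal w).subtype.toRingHom Subtype.val_injective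
    d (fun _ => rfl) (WeakDual.CharacterSpace.toAlgHom χ : diagonal w →+* ℂ) c.support.toList
  refine (le_of_eq ?_).trans (h x)
  congr 1
  change χ a = _
  rw [ha, symbol, Finsupp.linearCombination_apply, Finsupp.sum, map_sum]
  refine Finset.sum_congr rfl fun α hα => ?_
  rw [map_smul]
  change _ = c α • ite _ _ _
  rcases hx α (Finset.mem_toList.2 hα) with ⟨h1, h2⟩ | ⟨h1, h2⟩
  · rw [if_pos h1]
    exact congrArg _ h2
  · rw [if_neg h1]
    exact congrArg _ h2

/-- Compression by the isometry `w x` does not increase the norm, and moves evaluation at `x` to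
evaluation at `e`, where membership in an ideal means that the ideal is all of `P`. -/
theorem IsToeplitzFamily.norm_symbol_le {w : P → A} (hw : IsToeplitzFamily w)
    (hp : ∀ F : List (Word P), (∀ α ∈ F, Neutral α ∧ K α ≠ Set.univ) →
      (F.map fun α => 1 - wordProd w α).prod ≠ 0)
    (c : {α : Word P // Neutral α} →₀ ℂ) (x : P) : ‖symbol x c‖ ≤ ‖diagSum w c‖ := by
  classical
  -- These are the compressed words whose ideals miss `e`, hence are proper.
  set F : List (Word P) := (c.support.toList.filter fun α => x ∉ K α.1).map fun α => conj x α.1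
    with hF
  have hFn : ∀ β ∈ F, Neutral β ∧ K β ≠ Set.univ := by
    intro β hβ
    obtain ⟨α, hα, rfl⟩ := List.mem_map.1 hβ
    refine ⟨α.2.conj x, fun h => ?_⟩
    rw [K_eq_univ_iff, mem_K_conj α.2, mul_one] at h
    simpa [h] using (List.mem_filter.1 hα).2
  set Q := (F.map fun α => 1 - wordProd w α).prod with hQ
  have hQ0 : 0 < ‖Q‖ := norm_pos_iff.2 (hp F hFn)
  -- Each compressed term is `1` if `x ∈ K α`; otherwise its word belongs to `F` and `Q` annihilates
  -- it.
  have hmul : star (w x) * diagSum w c * w x * Q = symbol x c • Q := by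
    simp only [diagSum, symbol, Finsupp.linearCombination_apply, Finsupp.sum, Finset.mul_sum,
      Finset.sum_mul, Finset.sum_smul]
    refine Finset.sum_congr rfl fun α hα => ?_
    rw [mul_smul_comm, smul_mul_assoc, smul_mul_assoc, ← wordProd_conj hw.T1, smul_assoc]
    congr 1
    split_ifs with hx
    · rw [hw.wordProd_of_K_eq_univ (α.2.conj x), one_mul, one_smul]
      rwa [K_eq_univ_iff, mem_K_conj α.2, mul_one]
    · rw [zero_smul]
      exact hw.wordProd_mul_prod_one_sub (fun β hβ => (hFn β hβ).1)
        (List.mem_map.2 ⟨α, List.mem_filter.2 ⟨Finset.mem_toList.2 hα, by simpa using hx⟩, rfl⟩)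
  have : Nontrivial A := nontrivial_of_ne Q 0 (hp F hFn)
  have hwx : ‖w x‖ = 1 := by
    have h := CStarRing.norm_star_mul_self (x := w x)
    rw [hw.star_mul_self x, norm_one] at h
    nlinarith [norm_nonneg (w x)]
  refine le_of_mul_le_mul_right ?_ hQ0
  calc ‖symbol x c‖ * ‖Q‖ = ‖star (w x) * diagSum w c * w x * Q‖ := by rw [hmul, norm_smul]
    _ ≤ ‖star (w x)‖ * ‖diagSum w c‖ * ‖w x‖ * ‖Q‖ :=
        (norm_mul_le _ _).trans (mul_le_mul_of_nonneg_right norm_mul₃_le (norm_nonneg _))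
    _ = ‖diagSum w c‖ * ‖Q‖ := by rw [norm_star, hwx, one_mul, mul_one]

theorem continuous_starAlgHom {B : Type*} [CStarAlgebra B] (ρ : A →⋆ₐ[ℂ] B) : Continuous ρ :=
  AddMonoidHomClass.continuous_of_bound ρ 1 fun a => by
    rw [one_mul]
    exact NonUnitalStarAlgHom.norm_apply_le ρ a

/-- A jointly proper homomorphism is isometric on the diagonal. -/
theorem JointlyProper.norm_map {B : Type*} [CStarAlgebra B] {w : P → A} (hw : IsToeplitzFamily w)
    {ρ : A →⋆ₐ[ℂ] B} (hρ : JointlyProper w ρ) {a : A} (ha : a ∈ diagonal w) : ‖ρ a‖ = ‖a‖ := by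
  have hcont : Continuous ρ := continuous_starAlgHom ρ
  rw [← SetLike.mem_coe, coe_diagonal] at ha
  refine closure_minimal (t := {a | ‖ρ a‖ = ‖a‖}) ?_
    (isClosed_eq hcont.norm continuous_norm) ha
  rintro _ ⟨c, rfl⟩
  refine le_antisymm (NonUnitalStarAlgHom.norm_apply_le ρ _)
    (hw.norm_diagSum_le c (norm_nonneg _) fun x => ?_)
  rw [map_diagSum]
  refine (hw.map ρ).norm_symbol_le (fun F hF => ?_) c x
  have h := hρ F hF
  simp only [map_wordProd] at h
  exact h

theorem JointlyProper.injOn {B : Type*} [CStarAlgebra B] {w : P → A} (hw : IsToeplitzFamily w)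
    {ρ : A →⋆ₐ[ℂ] B} (hρ : JointlyProper w ρ) : Set.InjOn ρ (diagonal w : Set A) := by
  intro a ha b hb hab
  rw [← sub_eq_zero, ← norm_eq_zero, ← hρ.norm_map hw (sub_mem ha hb), map_sub, hab, sub_self,
    norm_zero]

/-- If some homomorphism is jointly proper, then so is every one that is injective on the
diagonal. -/
theorem JointlyProper.of_injOn {B C : Type*} [CStarAlgebra B] [Ring C] [StarRing C] [Algebra ℂ C] {w : P → A}
    {φ : A →⋆ₐ[ℂ] C} (hφ : JointlyProper w φ) {ρ : A →⋆ₐ[ℂ] B}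
    (hρ : Set.InjOn ρ (diagonal w : Set A)) : JointlyProper w ρ := by
  intro F hF h
  -- Injectivity is only assumed on the diagonal, so the product must first be placed there.
  have hmem : (F.map fun α => 1 - wordProd w α).prod ∈ diagonal w := by
    refine list_prod_mem fun a ha => ?_
    obtain ⟨α, hα, rfl⟩ := List.mem_map.1 ha
    exact sub_mem (one_mem _) (wordProd_mem_diagonal w (hF α hα).1)
  have h0 : (F.map fun α => 1 - wordProd w α).prod = 0 :=
    hρ hmem (zero_mem _) (by
      rw [map_zero, ← h, map_list_prod, List.map_map]
      congr 2
      funext α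
      simp)
  refine hφ F hF ?_
  rw [← map_zero φ, ← h0, map_list_prod, List.map_map]
  congr 2
  funext α
  simp

end Norm

/-! ### The regular representation and the three statements -/

section Main

variable {G : Type u} [Group G] {P : Submonoid G}

/-- A proper right ideal does not contain `e`, so each `L̇_α` kills `δ_e`. This vector witnesses
joint properness. -/
theorem prod_one_sub_L_delta_one {F : List (Word P)}
    (hF : ∀ α ∈ F, Neutral α ∧ K α ≠ Set.univ) :
    (F.map fun α => 1 - wordProd (L : P → ell2 P →L[ℂ] ell2 P) α).prod (delta P 1)
      = delta P 1 := by
  induction F with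
  | nil => rfl
  | cons α F ih =>
    obtain ⟨⟨hα, hK⟩, hF⟩ := List.forall_mem_cons.1 hF
    rw [List.map_cons, List.prod_cons, mul_apply_eq_comp, ih hF, sub_apply,
      wordProd_L_delta α hα, if_neg (mt K_eq_univ_iff.2 hK), zero_smul, sub_zero]
    rfl

theorem jointlyProper_subtype :
    JointlyProper (l P) (generated (L : P → ell2 P →L[ℂ] ell2 P)).subtype := by
  intro F hF h
  simp only [map_wordProd] at h
  have h1 := prod_one_sub_L_delta_one hF
  have h2 : (F.map fun α => 1 - wordProd (L : P → ell2 P →L[ℂ] ell2 P) α).prod = 0 := h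
  rw [h2] at h1
  exact (delta P).orthonormal.ne_zero 1 h1.symm

theorem jointlyProper_lambdaPlus : JointlyProper (t P) (lambdaPlus P) := by
  intro F hF h
  refine jointlyProper_subtype F hF ?_
  have h' := congrArg (generated (L : P → ell2 P →L[ℂ] ell2 P)).subtype h
  rw [map_list_prod, List.map_map, map_zero] at h'
  rw [← h']
  congr 2
  funext α
  rw [Function.comp_apply, map_sub, map_one, map_wordProd (lambdaPlus P)]
  rfl

/-- The spans of the generators correspond under `λ⁺`; the closures do too because the image of the
complete diagonal under an isometry is closed. -/
theorem lambdaPlus_image_fullDiagonal :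
    lambdaPlus P '' (fullDiagonal P) = (reducedDiagonal P : Set (ReducedToeplitz P)) := by
  have hcont : Continuous (lambdaPlus P) := continuous_starAlgHom (lambdaPlus P)
  have hr : lambdaPlus P '' Set.range (diagSum (t P)) = Set.range (diagSum (l P)) := by
    rw [← Set.range_comp]
    congr 1
    funext c
    exact map_diagSum (lambdaPlus P) (t P) c
  have hcl : IsClosed (lambdaPlus P '' (fullDiagonal P)) := by
    have hiso : Isometry ((lambdaPlus P).comp (fullDiagonal P).subtype) :=
      AddMonoidHomClass.isometry_of_norm _ fun a =>
        jointlyProper_lambdaPlus.norm_map (isToeplitzFamily_t P) a.2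
    have : CompleteSpace (fullDiagonal P) := (isClosed_diagonal (t P)).completeSpace_coe
    have h := hiso.isClosedEmbedding.isClosed_range
    rwa [StarAlgHom.coe_comp, Set.range_comp, StarSubalgebra.coe_subtype,
      Subtype.range_coe_subtype] at h
  refine Set.Subset.antisymm ?_ ?_
  · rw [fullDiagonal, reducedDiagonal, coe_diagonal, coe_diagonal, ← hr]
    exact image_closure_subset_closure_image hcont
  · rw [reducedDiagonal, coe_diagonal]
    refine closure_minimal ?_ hcl
    rw [← hr, fullDiagonal, coe_diagonal]
    exact Set.image_mono subset_closure

/-- The restriction of `λ⁺` to the diagonals. -/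
noncomputable def diagonalEquiv (P : Submonoid G) : fullDiagonal P ≃⋆ₐ[ℂ] reducedDiagonal P :=
  StarAlgEquiv.ofBijective
    (((lambdaPlus P).comp (fullDiagonal P).subtype).codRestrict (reducedDiagonal P) fun a => by
      rw [← SetLike.mem_coe, ← lambdaPlus_image_fullDiagonal]
      exact ⟨a, a.2, rfl⟩)
    ⟨fun a b hab => Subtype.ext (jointlyProper_lambdaPlus.injOn (isToeplitzFamily_t P) a.2 b.2
      (congrArg Subtype.val hab)), fun b => by
      have hb := b.2
      rw [← SetLike.mem_coe, ← lambdaPlus_image_fullDiagonal] at hb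
      obtain ⟨a, ha, h⟩ := hb
      exact ⟨⟨a, ha⟩, Subtype.ext h⟩⟩

theorem coe_diagonalEquiv (P : Submonoid G) (a : fullDiagonal P) :
    (diagonalEquiv P a : ReducedToeplitz P) = lambdaPlus P a := rfl

theorem injOn_fullDiagonal_iff {B : Type*} [CStarAlgebra B] (ρ : UniversalToeplitz P →⋆ₐ[ℂ] B) :
    Set.InjOn ρ (fullDiagonal P : Set (UniversalToeplitz P)) ↔ JointlyProper (t P) ρ :=
  ⟨jointlyProper_lambdaPlus.of_injOn, fun h => h.injOn (isToeplitzFamily_t P)⟩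

theorem injOn_reducedDiagonal_iff {B : Type*} [CStarAlgebra B] (ρ : ReducedToeplitz P →⋆ₐ[ℂ] B) :
    Set.InjOn ρ (reducedDiagonal P : Set (ReducedToeplitz P)) ↔ JointlyProper (l P) ρ :=
  ⟨fun h => by
    have hp := jointlyProper_subtype (P := P)
    exact hp.of_injOn (ρ := ρ) h,
  fun h => by exact h.injOn isToeplitzFamily_l⟩

end Main

end ToeplitzSemigroup

theorem mainTheorem9 {G : Type u} [Group G] (P : Submonoid G) :
    (∀ (B : Type v) [CStarAlgebra B] (ρ : ToeplitzSemigroup.UniversalToeplitz P →⋆ₐ[ℂ] B),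
      Set.InjOn ρ (ToeplitzSemigroup.fullDiagonal P : Set (ToeplitzSemigroup.UniversalToeplitz P)) ↔
        ToeplitzSemigroup.JointlyProper (ToeplitzSemigroup.t P) ρ) ∧
    (∃ e : ToeplitzSemigroup.fullDiagonal P ≃⋆ₐ[ℂ] ToeplitzSemigroup.reducedDiagonal P,
      ∀ a : ToeplitzSemigroup.fullDiagonal P,
        (e a : ToeplitzSemigroup.ReducedToeplitz P) = ToeplitzSemigroup.lambdaPlus P a) ∧
    (∀ (B : Type v) [CStarAlgebra B] (ρ : ToeplitzSemigroup.ReducedToeplitz P →⋆ₐ[ℂ] B),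
      Set.InjOn ρ
          (ToeplitzSemigroup.reducedDiagonal P : Set (ToeplitzSemigroup.ReducedToeplitz P)) ↔
        ToeplitzSemigroup.JointlyProper (ToeplitzSemigroup.l P) ρ) :=
  ⟨fun _ _ ρ => ToeplitzSemigroup.injOn_fullDiagonal_iff ρ,
    ⟨ToeplitzSemigroup.diagonalEquiv P, ToeplitzSemigroup.coe_diagonalEquiv P⟩,
    fun _ _ ρ => ToeplitzSemigroup.injOn_reducedDiagonal_iff ρ⟩
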